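/- Let $K$ be a field, let $E$ be a finite set, and let $A_1, A_2$ be $r \times |E|$ matrices over $K$ with columns indexed by $E$. For $B \subseteq E$ with $|B| = r$ let $A_k[B]$ be the square submatrix of the columns in $B$ (listed in a fixed linear order of $E$). A base of $A_k$ is an $r$-element set $B \subseteq E$ with $A_k[B]$ nonsingular; $\mathcal{B}(A_k)$ is the set of bases of $A_k$ and $\mathcal{B}(A_1, A_2) = \mathcal{B}(A_1) \cap \mathcal{B}(A_2)$ is the set of common bases. The pair $(A_1, A_2)$ is Pfaffian with constant $c \in K \setminus \{0\}$ if $\det A_1[B] \det A_2[B] = c$ for all $B \in \mathcal{B}(A_1, A_2)$, and Pfaffian if it is so with some constant $c \neq 0$. Let $(A_1, A_2)$ be a Pfaffian pair, let $w : E \to \mathbb{R}$, and write $w(J) = \sum_{j \in J} w(j)$ for $J \subseteq E$. Let $B$ be a common base of minimum weight $w(B)$ among all common bases. Let $w_1, w_2 : E \to \mathbb{R}$ be split weights, that is, $w_1(j) + w_2(j) = w(j)$ for all $j \in E$, and a common base $B'$ minimizes $w$ among all common bases if and only if $B'$ minimizes $w_1$ among all bases of $A_1$ and minimizes $w_2$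 among all bases of $A_2$. For $k = 1, 2$ put $P_k = A_k[B]^{-1} A_k$ (pivoting on $B$) and identify the rows of $P_k$ with the elements of $B$ in the order of the columns of $A_k[B]$. Let $A_k^\#$ be the matrix with rows indexed by $B$ and columns indexed by $E$ whose $(u,j)$ entry is $(P_k)_{u,j}$ if $w_k(u) = w_k(j)$ and $0$ otherwise. Then: 1. $P_1[B] = P_2[B] = I_r$, $\mathcal{B}(P_1, P_2) = \mathcal{B}(A_1, A_2)$, and $(P_1, P_2)$ is Pfaffian with constant $1$. 2. The set of minimum-weight common bases of $(A_1, A_2)$ with respect to $w$ equals $\mathcal{B}(A_1^\#, A_2^\#)$. 3. The pair $(A_1^\#, A_2^\#)$ is Pfaffian with constant $1$. 4. The number of minimum-weight common bases of $(A_1, A_2)$ equals $\det A_1^\# (A_2^\#)^{\top}$ over $K$, that is, its image in $K$ equals this determinant (equality modulo the characteristic of $K$). -/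

import Mathlib

namespace PfaffianPair

variable {K : Type*} [Field K] {E : Type*} [Fintype E] [LinearOrder E] {r : ℕ}

/-- The square submatrix `A[B]` of all rows of `A` and the columns in `B`, where `B` has as many
elements as `A` has rows. The columns are listed in increasing order. -/
def colSub (A : Matrix (Fin r) E K) (B : Finset E) (hB : B.card = r) :
    Matrix (Fin r) (Fin r) K :=
  A.submatrix id (B.orderEmbOfFin hB)

/-- The bases of `A`: the `r`-element column sets `B` with `A[B]` nonsingular. -/
def bases (A : Matrix (Fin r) E K) : Set (Finset E) :=
  {B | ∃ hB : B.card = r, (colSub A B hB).det ≠ 0}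

/-- The common bases of a matrix pair. -/
def commonBases (A₁ A₂ : Matrix (Fin r) E K) : Set (Finset E) :=
  bases A₁ ∩ bases A₂

/-- The pair `(A₁, A₂)` is Pfaffian with constant `c`. -/
def IsPfaffianWithConstant (A₁ A₂ : Matrix (Fin r) E K) (c : K) : Prop :=
  c ≠ 0 ∧ ∀ (B : Finset E) (hB : B.card = r), B ∈ commonBases A₁ A₂ →
    (colSub A₁ B hB).det * (colSub A₂ B hB).det = c

/-- The pair `(A₁, A₂)` is Pfaffian. -/
def IsPfaffian (A₁ A₂ : Matrix (Fin r) E K) : Prop :=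
  ∃ c : K, IsPfaffianWithConstant A₁ A₂ c

/-- The weight `w(J)` of a column set `J`. -/
def weight (w : E → ℝ) (J : Finset E) : ℝ := ∑ j ∈ J, w j

/-- The members of the set family `F` whose weight is minimum among all members of `F`. -/
def minWeight (w : E → ℝ) (F : Set (Finset E)) : Set (Finset E) :=
  {B | B ∈ F ∧ ∀ B' ∈ F, weight w B ≤ weight w B'}

/-- `w₁` and `w₂` are split weights of the column weight `w` for the pair `(A₁, A₂)`. -/
structure IsSplitWeight (A₁ A₂ : Matrix (Fin r) E K) (w w₁ w₂ : E → ℝ) : Prop where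
  add_eq : ∀ j, w₁ j + w₂ j = w j
  min_iff : ∀ B ∈ commonBases A₁ A₂,
    (B ∈ minWeight w (commonBases A₁ A₂) ↔
      B ∈ minWeight w₁ (bases A₁) ∧ B ∈ minWeight w₂ (bases A₂))

/-- Pivoting on `B`: the row transformation `A[B]⁻¹ A`, which turns `A[B]` into the identity
if `B` is a base of `A`. -/
noncomputable def pivot (A : Matrix (Fin r) E K) (B : Finset E) (hB : B.card = r) :
    Matrix (Fin r) E K :=
  (colSub A B hB)⁻¹ * A

/-- The matrix `A^#` of a matrix `A` (already pivoted on `B`) and a weight `w`: the entry in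
row `u` and column `j` is kept if `w u = w j` and replaced by zero otherwise. The rows are
identified with the elements of `B`, the `i`-th row with the `i`-th smallest element. -/
noncomputable def sharp (A : Matrix (Fin r) E K) (w : E → ℝ) (B : Finset E) (hB : B.card = r) :
    Matrix (Fin r) E K :=
  Matrix.of fun i j => if w (B.orderEmbOfFin hB i) = w j then A i j else 0

end PfaffianPair

namespace PfaffianPair

variable {K : Type*} [Field K] {E : Type*} [LinearOrder E] {r : ℕ}

/-! Pivoting divides every maximal minor of `A_k` by `det A_k[B]`, so the Pfaffian constant `c`
becomes `c⁻¹ * c = 1`. If `P_k` has a nonzero entry at `(u, j)`, then `B - u + j` is a base of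
`A_k`; as `B` is `w_k`-minimal, `w_k u ≤ w_k j` (`le_of_pivot_ne_zero`). Hence for `w_k(J) = w_k(B)`
each nonzero Leibniz term of `P_k[J]` uses only entries kept in `A_k^#`, and the minor is unchanged
(`det_colSub_sharp_pivot`). Any other `J` has zero minor in `A_k^#`. So the bases of `A_k^#` are the
`w_k`-minimal bases of `A_k`; split weights turn their intersection into the optimal common bases,
and Cauchy–Binet counts these with each summand equal to `1`. -/

theorem exists_perm_orderEmbOfFin_comp (J : Finset E) (hJ : J.card = r) (f : Fin r → E)
    (hf : Function.Injective f) (hfJ : ∀ i, f i ∈ J) :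
    ∃ σ : Equiv.Perm (Fin r), f = J.orderEmbOfFin hJ ∘ σ := by
  let g : Fin r → Fin r := fun i => (J.orderIsoOfFin hJ).symm ⟨f i, hfJ i⟩
  have hg : Function.Injective g := fun a b h => by
    have h' := (J.orderIsoOfFin hJ).symm.injective h
    exact hf (congrArg Subtype.val h')
  refine ⟨Equiv.ofBijective g (Finite.injective_iff_bijective.mp hg), ?_⟩
  funext i
  simp [g, ← Finset.coe_orderIsoOfFin_apply]

/-- Since `J` has `r` elements, a map from `Fin r` with image `J` is an enumeration of `J`. This
groups the terms of Cauchy–Binet by column set. -/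
theorem sum_filter_image_eq [Fintype E] (J : Finset E) (hJ : J.card = r) (F : (Fin r → E) → K) :
    ∑ p with Finset.univ.image p = J, F p =
      ∑ σ : Equiv.Perm (Fin r), F (J.orderEmbOfFin hJ ∘ σ) := by
  symm
  refine Finset.sum_bij (fun σ _ => J.orderEmbOfFin hJ ∘ σ) ?_ ?_ ?_ ?_
  · intro σ _
    rw [Finset.mem_filter]
    refine ⟨Finset.mem_univ _, ?_⟩
    rw [← Finset.image_image, Finset.image_univ_equiv]
    simp
  · intro σ _ τ _ h
    ext i : 1
    exact (J.orderEmbOfFin hJ).injective (congrFun h i)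
  · intro p hp
    have hpJ : Finset.univ.image p = J := (Finset.mem_filter.mp hp).2
    have hinj : Function.Injective p := by
      have h : (Finset.univ.image p).card = (Finset.univ : Finset (Fin r)).card := by
        rw [hpJ, hJ, Finset.card_fin]
      exact fun a b hab => Finset.card_image_iff.mp h (by simp) (by simp) hab
    obtain ⟨σ, hσ⟩ := exists_perm_orderEmbOfFin_comp J hJ p hinj
      (fun i => hpJ ▸ Finset.mem_image_of_mem p (Finset.mem_univ i))
    exact ⟨σ, Finset.mem_univ _, hσ.symm⟩
  · intro _ _
    rfl

/-- The **Cauchy–Binet formula**. -/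
theorem det_mul_transpose_eq_sum [Fintype E] (A N : Matrix (Fin r) E K) :
    (A * N.transpose).det =
      ∑ J : Finset E, if hJ : J.card = r then (colSub A J hJ).det * (colSub N J hJ).det else 0 := by
  -- Each row of `A * Nᵀ` is a combination of rows of `Nᵀ`; multilinearity picks one index `p i` per
  -- row.
  have expand : (A * N.transpose).det =
      ∑ p : Fin r → E, (∏ i, A i (p i)) * (N.submatrix id p).det := by
    have h : A * N.transpose = fun i => ∑ j, A i j • N.transpose j := by
      ext i k
      simp [Matrix.mul_apply]
    rw [h]
    change Matrix.detRowAlternating.toMultilinearMap _ = _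
    rw [MultilinearMap.map_sum]
    refine Finset.sum_congr rfl fun p _ => ?_
    rw [MultilinearMap.map_smul_univ, smul_eq_mul, ← Matrix.det_transpose (N.submatrix id p)]
    rfl
  rw [expand, ← Finset.sum_fiberwise Finset.univ (fun p : Fin r → E => Finset.univ.image p)]
  refine Finset.sum_congr rfl fun J _ => ?_
  split_ifs with hJ
  · rw [sum_filter_image_eq J hJ]
    have h : ∀ σ : Equiv.Perm (Fin r), (N.submatrix id (J.orderEmbOfFin hJ ∘ σ)).det =
        Equiv.Perm.sign σ * (colSub N J hJ).det := fun σ =>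
      Matrix.det_permute' σ (colSub N J hJ)
    simp_rw [h]
    rw [← Matrix.det_transpose (colSub A J hJ), Matrix.det_apply' (colSub A J hJ).transpose,
      Finset.sum_mul]
    refine Finset.sum_congr rfl fun σ _ => ?_
    simp only [colSub, Matrix.transpose_apply, Matrix.submatrix_apply, id, Function.comp]
    ring
  · refine Finset.sum_eq_zero fun p hp => ?_
    have hninj : ¬ Function.Injective p := fun hinj => hJ <| by
      rw [← (Finset.mem_filter.mp hp).2, Finset.card_image_of_injective _ hinj, Finset.card_fin]
    simp only [Function.Injective, not_forall] at hninj
    obtain ⟨a, b, hab, hne⟩ := hninj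
    rw [Matrix.det_zero_of_column_eq hne (fun k => by simp [hab]), mul_zero]

theorem mem_bases_iff (A : Matrix (Fin r) E K) (J : Finset E) (hJ : J.card = r) :
    J ∈ bases A ↔ (colSub A J hJ).det ≠ 0 :=
  ⟨fun ⟨_, h⟩ => h, fun h => ⟨hJ, h⟩⟩

/-- Sorting the columns changes the determinant only by a sign. Column exchange needs this, since it
leaves the columns unsorted. -/
theorem mem_bases_of_det_submatrix_ne_zero (A : Matrix (Fin r) E K) (f : Fin r → E)
    (hf : (A.submatrix id f).det ≠ 0) : Finset.univ.image f ∈ bases A := by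
  have hinj : Function.Injective f := fun a b hab => by
    by_contra hne
    exact hf (Matrix.det_zero_of_column_eq hne fun k => by simp [hab])
  have hJ : (Finset.univ.image f).card = r := by
    rw [Finset.card_image_of_injective _ hinj, Finset.card_fin]
  obtain ⟨σ, hσ⟩ := exists_perm_orderEmbOfFin_comp _ hJ f hinj
    (fun i => Finset.mem_image_of_mem f (Finset.mem_univ i))
  refine ⟨hJ, fun h0 => hf ?_⟩
  have h : (A.submatrix id f).det = Equiv.Perm.sign σ * (colSub A _ hJ).det := by
    conv_lhs => rw [hσ]
    exact Matrix.det_permute' σ (colSub A _ hJ)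
  rw [h, h0, mul_zero]

theorem weight_eq_sum_orderEmbOfFin (w : E → ℝ) (J : Finset E) (hJ : J.card = r) :
    weight w J = ∑ i, w (J.orderEmbOfFin hJ i) := by
  have h : Finset.univ.image (J.orderEmbOfFin hJ) = J := by simp
  conv_lhs => rw [weight, ← h]
  exact Finset.sum_image fun a _ b _ hab => (J.orderEmbOfFin hJ).injective hab

section Pivot

variable (A : Matrix (Fin r) E K) (B : Finset E) (hBr : B.card = r)

theorem submatrix_pivot (f : Fin r → E) :
    (pivot A B hBr).submatrix id f = (colSub A B hBr)⁻¹ * A.submatrix id f := rfl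

theorem det_colSub_pivot (J : Finset E) (hJ : J.card = r) :
    (colSub (pivot A B hBr) J hJ).det = (colSub A B hBr).det⁻¹ * (colSub A J hJ).det := by
  rw [colSub, submatrix_pivot, Matrix.det_mul, Matrix.det_nonsing_inv, Ring.inverse_eq_inv]
  rfl

variable {A B}

theorem colSub_pivot_self (hB : B ∈ bases A) : colSub (pivot A B hBr) B hBr = 1 :=
  Matrix.nonsing_inv_mul _ (isUnit_iff_ne_zero.mpr ((mem_bases_iff A B hBr).mp hB))

theorem bases_pivot (hB : B ∈ bases A) : bases (pivot A B hBr) = bases A := by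
  have hdet := (mem_bases_iff A B hBr).mp hB
  ext J
  refine exists_congr fun hJ => ?_
  rw [det_colSub_pivot]
  simp [hdet]

/-- Exchanging one column of a minimum-weight base does not decrease the weight. -/
theorem le_of_pivot_ne_zero {w : E → ℝ} (hB : B ∈ minWeight w (bases A)) {i : Fin r} {j : E}
    (hij : pivot A B hBr i j ≠ 0) : w (B.orderEmbOfFin hBr i) ≤ w j := by
  have hone := colSub_pivot_self hBr hB.1
  set e := B.orderEmbOfFin hBr
  -- Replacing column `i` in place gives the identity with one column changed, whose determinant is
  -- the pivot entry by Cramer's rule.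
  have hsub : (pivot A B hBr).submatrix id (Function.update e i j) =
      (1 : Matrix (Fin r) (Fin r) K).updateCol i (fun k => pivot A B hBr k j) := by
    ext a b
    rcases eq_or_ne b i with rfl | hb
    · simp
    · rw [Matrix.updateCol_ne hb, ← hone]
      simp [colSub, hb, e]
  have hdet : ((pivot A B hBr).submatrix id (Function.update e i j)).det = pivot A B hBr i j := by
    rw [hsub, ← Matrix.cramer_apply, Matrix.cramer_one]
    rfl
  have hne : ((pivot A B hBr).submatrix id (Function.update e i j)).det ≠ 0 := hdet ▸ hij
  have hmem := mem_bases_of_det_submatrix_ne_zero _ _ hne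
  have hinj : Function.Injective (Function.update e i j) := fun a b hab => by
    by_contra h
    exact hne (Matrix.det_zero_of_column_eq h fun k => by
      simp only [Matrix.submatrix_apply, hab])
  rw [bases_pivot hBr hB.1] at hmem
  have hle := hB.2 _ hmem
  rw [weight_eq_sum_orderEmbOfFin w B hBr, weight,
    Finset.sum_image fun a _ b _ hab => hinj hab,
    ← Finset.add_sum_erase _ _ (Finset.mem_univ i),
    ← Finset.add_sum_erase _ (fun k => w (Function.update e i j k)) (Finset.mem_univ i)] at hle
  have hrest : ∑ k ∈ Finset.univ.erase i, w (Function.update e i j k) =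
      ∑ k ∈ Finset.univ.erase i, w (e k) :=
    Finset.sum_congr rfl fun k hk => by rw [Function.update_of_ne (Finset.ne_of_mem_erase hk)]
  rw [hrest, Function.update_self] at hle
  exact le_of_add_le_add_right hle

theorem det_colSub_sharp_pivot {w : E → ℝ} (hB : B ∈ minWeight w (bases A)) (J : Finset E)
    (hJ : J.card = r) (hw : weight w J = weight w B) :
    (colSub (sharp (pivot A B hBr) w B hBr) J hJ).det = (colSub (pivot A B hBr) J hJ).det := by
  rw [← Matrix.det_transpose, ← Matrix.det_transpose (colSub (pivot A B hBr) J hJ),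
    Matrix.det_apply', Matrix.det_apply']
  refine Finset.sum_congr rfl fun σ _ => congrArg _ ?_
  simp only [colSub, sharp, Matrix.transpose_apply, Matrix.submatrix_apply, id, Matrix.of_apply]
  by_cases h : ∀ i, pivot A B hBr i (J.orderEmbOfFin hJ (σ i)) ≠ 0
  · refine Finset.prod_congr rfl fun i _ => if_pos ?_
    -- Termwise inequalities between equal sums are all equalities.
    have hsum : ∑ i, w (B.orderEmbOfFin hBr i) = ∑ i, w (J.orderEmbOfFin hJ (σ i)) := by
      rw [Equiv.sum_comp σ (fun i => w (J.orderEmbOfFin hJ i)),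
        ← weight_eq_sum_orderEmbOfFin, ← weight_eq_sum_orderEmbOfFin, hw]
    exact (Finset.sum_eq_sum_iff_of_le fun i _ => le_of_pivot_ne_zero hBr hB (h i)).mp hsum i
      (Finset.mem_univ i)
  · push Not at h
    obtain ⟨i, hi⟩ := h
    exact (Finset.prod_eq_zero (Finset.mem_univ i) (by rw [hi, ite_self])).trans
      (Finset.prod_eq_zero (Finset.mem_univ i) hi).symm

/-- A nonzero Leibniz term is a weight-preserving bijection from `B` to `J`; minimality of `B` plays
no role. -/
theorem weight_eq_of_mem_bases_sharp (P : Matrix (Fin r) E K) {w : E → ℝ} {J : Finset E}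
    (hJ : J ∈ bases (sharp P w B hBr)) : weight w J = weight w B := by
  obtain ⟨hJr, hdet⟩ := hJ
  rw [← Matrix.det_transpose, Matrix.det_apply'] at hdet
  obtain ⟨σ, _, hσ⟩ := Finset.exists_ne_zero_of_sum_ne_zero hdet
  have hprod := Finset.prod_ne_zero_iff.mp (right_ne_zero_of_mul hσ)
  rw [weight_eq_sum_orderEmbOfFin w J hJr, weight_eq_sum_orderEmbOfFin w B hBr,
    ← Equiv.sum_comp σ]
  refine Finset.sum_congr rfl fun i _ => ?_
  by_contra hne
  refine hprod i (Finset.mem_univ i) ?_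
  simp only [colSub, sharp, Matrix.transpose_apply, Matrix.submatrix_apply, id, Matrix.of_apply]
  exact if_neg (Ne.symm hne)

/-- The bases of `A^#` are the minimum-weight bases of `A`. -/
theorem bases_sharp_pivot {w : E → ℝ} (hB : B ∈ minWeight w (bases A)) :
    bases (sharp (pivot A B hBr) w B hBr) = minWeight w (bases A) := by
  ext J
  constructor
  · intro hJ
    have hw := weight_eq_of_mem_bases_sharp hBr _ hJ
    refine ⟨?_, fun J' hJ' => hw ▸ hB.2 J' hJ'⟩
    obtain ⟨hJr, hdet⟩ := hJ
    rw [det_colSub_sharp_pivot hBr hB J hJr hw] at hdet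
    rw [← bases_pivot hBr hB.1]
    exact ⟨hJr, hdet⟩
  · intro hJ
    have hw : weight w J = weight w B := le_antisymm (hJ.2 B hB.1) (hB.2 J hJ.1)
    have hJ' := hJ.1
    rw [← bases_pivot hBr hB.1] at hJ'
    obtain ⟨hJr, hdet⟩ := hJ'
    refine ⟨hJr, ?_⟩
    rwa [det_colSub_sharp_pivot hBr hB J hJr hw]

end Pivot

/-- A Pfaffian pair with constant `1` has `det (A₁ * A₂ᵀ)` common bases. -/
theorem IsPfaffianWithConstant.ncard_commonBases [Fintype E] {A₁ A₂ : Matrix (Fin r) E K}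
    (h : IsPfaffianWithConstant A₁ A₂ 1) :
    ((commonBases A₁ A₂).ncard : K) = (A₁ * A₂.transpose).det := by
  classical
  rw [det_mul_transpose_eq_sum, Set.ncard_eq_toFinset_card', Finset.card_eq_sum_ones,
    Nat.cast_sum, Finset.sum_subset_zero_on_sdiff (Finset.subset_univ _)]
  · intro J hJ
    have hJ' : J ∉ commonBases A₁ A₂ := by simpa using hJ
    split_ifs with hJr
    · by_contra hne
      exact hJ' ⟨⟨hJr, left_ne_zero_of_mul hne⟩, ⟨hJr, right_ne_zero_of_mul hne⟩⟩
    · rfl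
  · intro J hJ
    have hJ' : J ∈ commonBases A₁ A₂ := by simpa using hJ
    rw [dif_pos hJ'.1.1, h.2 J hJ'.1.1 hJ', Nat.cast_one]

end PfaffianPair

theorem mainTheorem11 {K : Type*} [Field K] {E : Type*} [Fintype E] [LinearOrder E] {r : ℕ}
    (A₁ A₂ : Matrix (Fin r) E K) (hA : PfaffianPair.IsPfaffian A₁ A₂)
    (w : E → ℝ)
    (B : Finset E) (hBr : B.card = r)
    (hB : B ∈ PfaffianPair.minWeight w (PfaffianPair.commonBases A₁ A₂))
    (w₁ w₂ : E → ℝ) (hw : PfaffianPair.IsSplitWeight A₁ A₂ w w₁ w₂)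
    (P₁ P₂ S₁ S₂ : Matrix (Fin r) E K)
    (hP₁ : P₁ = PfaffianPair.pivot A₁ B hBr) (hP₂ : P₂ = PfaffianPair.pivot A₂ B hBr)
    (hS₁ : S₁ = PfaffianPair.sharp P₁ w₁ B hBr) (hS₂ : S₂ = PfaffianPair.sharp P₂ w₂ B hBr) :
    (PfaffianPair.colSub P₁ B hBr = 1 ∧ PfaffianPair.colSub P₂ B hBr = 1 ∧
      PfaffianPair.commonBases P₁ P₂ = PfaffianPair.commonBases A₁ A₂ ∧
      PfaffianPair.IsPfaffianWithConstant P₁ P₂ 1) ∧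
    PfaffianPair.minWeight w (PfaffianPair.commonBases A₁ A₂) =
      PfaffianPair.commonBases S₁ S₂ ∧
    PfaffianPair.IsPfaffianWithConstant S₁ S₂ 1 ∧
    ((PfaffianPair.minWeight w (PfaffianPair.commonBases A₁ A₂)).ncard : K) =
      (S₁ * S₂.transpose).det := by
  subst hP₁ hP₂ hS₁ hS₂
  obtain ⟨hmin₁, hmin₂⟩ := (hw.min_iff B hB.1).mp hB
  have hcommon : PfaffianPair.commonBases (PfaffianPair.pivot A₁ B hBr)
      (PfaffianPair.pivot A₂ B hBr) = PfaffianPair.commonBases A₁ A₂ := by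
    rw [PfaffianPair.commonBases, PfaffianPair.bases_pivot hBr hB.1.1,
      PfaffianPair.bases_pivot hBr hB.1.2, PfaffianPair.commonBases]
  have hpf : PfaffianPair.IsPfaffianWithConstant
      (PfaffianPair.pivot A₁ B hBr)
      (PfaffianPair.pivot A₂ B hBr) 1 := by
    obtain ⟨c, hc, hconst⟩ := hA
    refine ⟨one_ne_zero, fun J hJ hJmem => ?_⟩
    rw [hcommon] at hJmem
    rw [PfaffianPair.det_colSub_pivot, PfaffianPair.det_colSub_pivot, mul_mul_mul_comm, ← mul_inv,
      hconst B hBr hB.1,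
      hconst J hJ hJmem, inv_mul_cancel₀ hc]
  have hsharp : PfaffianPair.minWeight w (PfaffianPair.commonBases A₁ A₂) =
      PfaffianPair.commonBases (PfaffianPair.sharp (PfaffianPair.pivot A₁ B hBr) w₁ B hBr)
        (PfaffianPair.sharp (PfaffianPair.pivot A₂ B hBr) w₂ B hBr) := by
    change _ = PfaffianPair.bases _ ∩ PfaffianPair.bases _
    rw [PfaffianPair.bases_sharp_pivot hBr hmin₁,
      PfaffianPair.bases_sharp_pivot hBr hmin₂]
    ext J
    -- `min_iff` speaks of common bases only; in the converse, minimality for both weights already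
    -- includes being a common base.
    exact ⟨fun hJ => (hw.min_iff J hJ.1).mp hJ,
      fun hJ => (hw.min_iff J ⟨hJ.1.1, hJ.2.1⟩).mpr hJ⟩
  have hpfsharp : PfaffianPair.IsPfaffianWithConstant
      (PfaffianPair.sharp (PfaffianPair.pivot A₁ B hBr) w₁ B hBr)
      (PfaffianPair.sharp (PfaffianPair.pivot A₂ B hBr) w₂ B hBr) 1 := by
    refine ⟨one_ne_zero, fun J hJ hJmem => ?_⟩
    rw [PfaffianPair.det_colSub_sharp_pivot hBr hmin₁ J hJ
        (PfaffianPair.weight_eq_of_mem_bases_sharp hBr _ hJmem.1),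
      PfaffianPair.det_colSub_sharp_pivot hBr hmin₂ J hJ
        (PfaffianPair.weight_eq_of_mem_bases_sharp hBr _ hJmem.2)]
    rw [← hsharp] at hJmem
    exact hpf.2 J hJ (hcommon ▸ hJmem.1)
  exact ⟨⟨PfaffianPair.colSub_pivot_self hBr hB.1.1,
    PfaffianPair.colSub_pivot_self hBr hB.1.2, hcommon, hpf⟩, hsharp,
    hpfsharp, hsharp ▸ hpfsharp.ncard_commonBases⟩
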